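/- **Theorem.** Let $N,K,n\in\mathbb N$, let $f_1,\dots,f_N:\mathbb R^n\to\mathbb R$ be differentiable and convex, and suppose that $F=\sum_{i=1}^N f_i$ is strictly convex and attains its minimum, at the point $y^*\in\mathbb R^n$. Let $\alpha_1,\dots,\alpha_N>0$ and $\beta_1,\dots,\beta_K>0$, and let $E\in\mathbb R^{N\times K}$ be a matrix with the nullspace property $$\ker(E^\top)=\{a\,\mathbf 1_N \mid a\in\mathbb R\}$$ (for instance, the incidence matrix of a connected graph). Consider the agents $i=1,\dots,N$ and the controllers $k=1,\dots,K$, $$\dot x_i=-\alpha_i\nabla f_i(x_i)+\alpha_i u_i,\quad y_i=x_i,\qquad\qquad \dot z_k=\beta_k\zeta_k,\quad d_k=z_k+\beta_k\zeta_k,$$ with all variables in $\mathbb R^n$, coupled through the symmetric interconnection $$\zeta=(E\otimes I_n)^\top y,\qquad u=-(E\otimes I_n)\,d .$$ Let $\mathcal M_{\rm eq}=\{(y,d)\mid y=\mathbf 1_N\otimes y^*\}$. Then: 1. Every trajectory of the closed loop on $[0,\infty)$ converges, as $t\to\infty$, to an equilibrium of the closed loop in $\mathcal M_{\rm eq}$: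 there is an equilibrium $(\bar x,\bar u,\bar y,\bar z,\bar\zeta,\bar d)$ (all right-hand sides vanish and all output and interconnection equations hold) with $(\bar y,\bar d)\in\mathcal M_{\rm eq}$, that is, $\bar y_i=y^*$ for all $i$, and $x(t),u(t),y(t),z(t),\zeta(t),d(t)$ converge to $\bar x,\bar u,\bar y,\bar z,\bar\zeta,\bar d$ respectively. No strong convexity is needed. 2. No trajectory escapes in finite time: a trajectory on a bounded interval $[0,T)$ has bounded states $x$ and $z$ there. 3. The set of equilibria is positively invariant: a trajectory on $[0,\infty)$ that starts at an equilibrium stays there. -/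

import Mathlib

namespace DistOpt

/-- The space `ℝⁿ` with its Euclidean structure. -/
abbrev Vec (n : ℕ) : Type := EuclideanSpace ℝ (Fin n)

/-- Right-hand side `-α ∇f(x) + α u` of the gradient-flow agent. -/
noncomputable def agentField {n : ℕ} (α : ℝ) (f : Vec n → ℝ) (x u : Vec n) : Vec n :=
  -(α • gradient f x) + α • u

/-- Right-hand side `β ζ` of the integrator controller. -/
noncomputable def controllerField {n : ℕ} (β : ℝ) (ζ : Vec n) : Vec n := β • ζ

/-- Output `z + β ζ` of the integrator controller with feedthrough. -/
noncomputable def controllerOutput {n : ℕ} (β : ℝ) (z ζ : Vec n) : Vec n := z + β • ζ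

/-- Blocks of `ζ = (E ⊗ Iₙ)ᵀ y`. -/
noncomputable def controllerInput {N K n : ℕ} (E : Matrix (Fin N) (Fin K) ℝ)
    (y : Fin N → Vec n) (k : Fin K) : Vec n :=
  ∑ i, E i k • y i

/-- Blocks of `u = -(E ⊗ Iₙ) d`. -/
noncomputable def agentInput {N K n : ℕ} (E : Matrix (Fin N) (Fin K) ℝ)
    (d : Fin K → Vec n) (i : Fin N) : Vec n :=
  -∑ k, E i k • d k

/-- The nullspace property `ker Eᵀ = {a 1 | a ∈ ℝ}`. -/
def NullspaceProperty {N K : ℕ} (E : Matrix (Fin N) (Fin K) ℝ) : Prop :=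
  {v : Fin N → ℝ | E.transpose.mulVec v = 0} = {v | ∃ a : ℝ, v = fun _ => a}

/-- The signals of the closed loop (agents: state `x`, input `u`, output `y`; controllers:
state `z`, input `ζ`, output `d`) satisfy, on the time interval `J`, the agent dynamics, the
controller dynamics and the interconnection. -/
structure IsTrajectoryOn {N K n : ℕ} (f : Fin N → Vec n → ℝ) (α : Fin N → ℝ) (β : Fin K → ℝ)
    (E : Matrix (Fin N) (Fin K) ℝ) (J : Set ℝ)
    (x u y : ℝ → Fin N → Vec n) (z ζ d : ℝ → Fin K → Vec n) : Prop where
  agent_dyn : ∀ t ∈ J, ∀ i,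
    HasDerivWithinAt (fun s => x s i) (agentField (α i) (f i) (x t i) (u t i)) J t
  agent_out : ∀ t ∈ J, ∀ i, y t i = x t i
  ctrl_dyn : ∀ t ∈ J, ∀ k,
    HasDerivWithinAt (fun s => z s k) (controllerField (β k) (ζ t k)) J t
  ctrl_out : ∀ t ∈ J, ∀ k, d t k = controllerOutput (β k) (z t k) (ζ t k)
  ctrl_in : ∀ t ∈ J, ∀ k, ζ t k = controllerInput E (y t) k
  agent_in : ∀ t ∈ J, ∀ i, u t i = agentInput E (d t) i

/-- Constant signals at which the closed loop is at rest. -/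
structure IsEquilibrium {N K n : ℕ} (f : Fin N → Vec n → ℝ) (α : Fin N → ℝ) (β : Fin K → ℝ)
    (E : Matrix (Fin N) (Fin K) ℝ)
    (x u y : Fin N → Vec n) (z ζ d : Fin K → Vec n) : Prop where
  agent_dyn : ∀ i, agentField (α i) (f i) (x i) (u i) = 0
  agent_out : ∀ i, y i = x i
  ctrl_dyn : ∀ k, controllerField (β k) (ζ k) = 0
  ctrl_out : ∀ k, d k = controllerOutput (β k) (z k) (ζ k)
  ctrl_in : ∀ k, ζ k = controllerInput E y k
  agent_in : ∀ i, u i = agentInput E d i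

/-- The manifold of pairs `(y, d)` with all agent outputs equal to `yopt`. -/
def optimalManifold (N K : ℕ) {n : ℕ} (yopt : Vec n) : Set ((Fin N → Vec n) × (Fin K → Vec n)) :=
  {p | ∀ i, p.1 i = yopt}

end DistOpt

/-! At an optimal equilibrium the controller states `zs` satisfy `agentInput E zs i = gradient (f i)
xs` with `xs` the minimizer. Such `zs` exist because the gradients sum to zero at `xs` and the range
of `E` is the orthogonal complement of `ker Eᵀ`, the constants. The weighted squared distance
`lyapunov` to this equilibrium is nonincreasing: the skew interconnection cancels, leaving gradient
monotonicity and the feedthrough term `β‖ζ‖²` (`hasDerivWithinAt_lyapunov`). This bounds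
trajectories.

By Barbalat's lemma the dissipation tends to zero. It vanishes only at consensus on `xs`
(`eq_of_dissipation_eq_zero`), so `x` converges; Barbalat applied to `x` gives vanishing agent
velocity. Every cluster point of `(x, z)` is therefore an equilibrium, and the Lyapunov function
recentred there tends to zero, so the whole trajectory converges. -/

open Filter Topology Set
open scoped InnerProductSpace

/-! ### Convex functions, Barbalat's lemma and cluster points -/

/-- The tangent hyperplane of a convex function lies below its graph. -/
theorem ConvexOn.inner_gradient_le {V : Type*} [NormedAddCommGroup V] [InnerProductSpace ℝ V]
    [CompleteSpace V] {f : V → ℝ} (hf : ConvexOn ℝ univ f) {x : V} (hd : DifferentiableAt ℝ f x)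
    (y : V) : ⟪gradient f x, y - x⟫_ℝ ≤ f y - f x := by
  have hc := hf.comp_affineMap (AffineMap.lineMap (k := ℝ) x y)
  have hd' : HasDerivAt (f ∘ AffineMap.lineMap (k := ℝ) x y) (fderiv ℝ f x (y - x)) 0 := by
    have h : HasFDerivAt f (fderiv ℝ f x) (AffineMap.lineMap (k := ℝ) x y 0) := by
      simpa using hd.hasFDerivAt
    exact h.comp_hasDerivAt 0 AffineMap.hasDerivAt_lineMap
  have := hc.le_slope_of_hasDerivAt (x := 0) (y := 1) (by simp) (by simp) one_pos hd'
  simpa [slope_def_field, inner_gradient_left] using this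

/-- The gradient of a differentiable convex function is continuous. -/
theorem ConvexOn.continuous_gradient {V : Type*} [NormedAddCommGroup V] [InnerProductSpace ℝ V]
    [CompleteSpace V] {f : V → ℝ} (hf : ConvexOn ℝ univ f) (hd : Differentiable ℝ f) :
    Continuous (gradient f) := by
  rw [continuous_iff_continuousAt]
  intro y
  rw [Metric.continuousAt_iff]
  intro ε hε
  have ho := (hasGradientAt_iff_isLittleO.1 (hd y).hasGradientAt).def (c := ε / 4) (by positivity)
  obtain ⟨r, hr, hball⟩ := Metric.eventually_nhds_iff.1 ho
  refine ⟨r / 2, by positivity, fun {x} hx => ?_⟩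
  set g := gradient f x - gradient f y with hg
  rw [dist_eq_norm, ← hg]
  rcases eq_or_ne g 0 with h0 | h0
  · simpa [h0] using hε
  rcases eq_or_ne x y with rfl | hxy
  · simp [hg] at h0
  have hgpos : 0 < ‖g‖ := norm_pos_iff.2 h0
  have hdpos : 0 < ‖x - y‖ := norm_pos_iff.2 (sub_ne_zero.2 hxy)
  -- Moving from `x` along `g` by `‖x - y‖` stays within `r` of `y`. The tangent inequalities at `x`
  -- and `y` and the expansion at `y` then bound `⟪g, v⟫` by `ε / 4 * (2 * ‖x - y‖)`.
  set v : V := (‖x - y‖ / ‖g‖) • g with hv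
  have hvn : ‖v‖ = ‖x - y‖ := by
    rw [hv, norm_smul, Real.norm_of_nonneg (by positivity)]
    field_simp
  have hle : ‖x + v - y‖ ≤ 2 * ‖x - y‖ := by
    calc ‖x + v - y‖ = ‖(x - y) + v‖ := by congr 1; abel
      _ ≤ ‖x - y‖ + ‖v‖ := norm_add_le _ _
      _ = 2 * ‖x - y‖ := by rw [hvn]; ring
  have h1 := hball (y := x + v) (by
    rw [dist_eq_norm] at hx ⊢
    linarith)
  have h2 := hf.inner_gradient_le (hd x) (x + v)
  have h3 := hf.inner_gradient_le (hd y) x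
  rw [add_sub_cancel_left] at h2
  have h4 : ⟪g, v⟫_ℝ = ‖x - y‖ * ‖g‖ := by
    rw [hv, inner_smul_right, real_inner_self_eq_norm_sq]
    field_simp
  have h5 : ⟪g, v⟫_ℝ = ⟪gradient f x, v⟫_ℝ - ⟪gradient f y, v⟫_ℝ := by rw [hg, inner_sub_left]
  have h6 : ⟪gradient f y, x + v - y⟫_ℝ = ⟪gradient f y, x - y⟫_ℝ + ⟪gradient f y, v⟫_ℝ := by
    rw [← inner_add_right]; congr 1; abel
  rw [Real.norm_eq_abs] at h1
  have h7 := le_of_abs_le h1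
  have h8 : ‖x - y‖ * ‖g‖ ≤ ‖x - y‖ * (ε / 2) := by nlinarith
  have := le_of_mul_le_mul_left h8 hdpos
  linarith

/-- Barbalat's lemma: a convergent function with uniformly continuous derivative has a derivative
tending to zero. -/
theorem tendsto_deriv_zero_of_tendsto {V : Type*} [NormedAddCommGroup V] [NormedSpace ℝ V]
    {w w' : ℝ → V} {l : V} (hw : ∀ t ∈ Ici (0 : ℝ), HasDerivWithinAt w (w' t) (Ici 0) t)
    (hl : Tendsto w atTop (𝓝 l)) (huc : UniformContinuousOn w' (Ici 0)) :
    Tendsto w' atTop (𝓝 0) := by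
  rw [Metric.tendsto_atTop]
  intro ε hε
  obtain ⟨δ, hδ, huc⟩ := Metric.uniformContinuousOn_iff.1 huc (ε / 3) (by positivity)
  have hstep : Tendsto (fun t => w (t + δ / 2) - w t) atTop (𝓝 0) := by
    simpa using (hl.comp (tendsto_atTop_add_const_right _ (δ / 2) tendsto_id)).sub hl
  obtain ⟨T, hT⟩ := Metric.tendsto_atTop.1 hstep (ε / 3 * (δ / 2)) (by positivity)
  refine ⟨max T 0, fun t ht => ?_⟩
  have ht0 : 0 ≤ t := (le_max_right _ _).trans ht
  have h1 := hT t ((le_max_left _ _).trans ht)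
  have hsub : Icc t (t + δ / 2) ⊆ Ici 0 := fun s hs => ht0.trans hs.1
  -- Subtracting the linear motion with velocity `w' t` leaves a derivative of norm at most `ε / 3`
  -- on this interval.
  have h2 := (convex_Icc t (t + δ / 2)).norm_image_sub_le_of_norm_hasDerivWithin_le
    (f := fun s => w s - s • w' t) (f' := fun s => w' s - (1 : ℝ) • w' t) (C := ε / 3)
    (x := t) (y := t + δ / 2)
    (fun s hs => ((hw s (hsub hs)).mono hsub).sub ((hasDerivWithinAt_id s _).smul_const _))
    (fun s hs => by
      rw [one_smul, ← dist_eq_norm]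
      refine (huc s (hsub hs) t ht0 ?_).le
      rw [Real.dist_eq, abs_of_nonneg (by linarith [hs.1])]
      linarith [hs.2])
    (by constructor <;> linarith) (by constructor <;> linarith)
  have h3 : (δ / 2) • w' t = (w (t + δ / 2) - w t) -
      ((w (t + δ / 2) - (t + δ / 2) • w' t) - (w t - t • w' t)) := by
    rw [add_smul]; abel
  have h4 : δ / 2 * ‖w' t‖ < δ / 2 * ε := by
    calc δ / 2 * ‖w' t‖ = ‖(δ / 2) • w' t‖ := by
          rw [norm_smul, Real.norm_of_nonneg (by positivity)]
      _ ≤ ‖w (t + δ / 2) - w t‖ +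
          ‖(w (t + δ / 2) - (t + δ / 2) • w' t) - (w t - t • w' t)‖ := by
          rw [h3]; exact norm_sub_le _ _
      _ < δ / 2 * ε := by
          rw [dist_zero_right] at h1
          rw [add_sub_cancel_left, Real.norm_of_nonneg (by positivity)] at h2
          nlinarith
  rw [dist_zero_right]
  exact lt_of_mul_lt_mul_left h4 (by positivity)

/-- A solution of an autonomous equation with continuous right-hand side that stays in a compact
set is uniformly continuous. -/
theorem uniformContinuousOn_of_hasDerivWithinAt_of_mem_isCompact {V : Type*}
    [NormedAddCommGroup V] [NormedSpace ℝ V] {w : ℝ → V} {G : V → V} {S : Set V}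
    (hG : Continuous G) (hS : IsCompact S)
    (hw : ∀ t ∈ Ici (0 : ℝ), HasDerivWithinAt w (G (w t)) (Ici 0) t)
    (hmem : ∀ t ∈ Ici (0 : ℝ), w t ∈ S) : UniformContinuousOn w (Ici 0) := by
  obtain ⟨C, hC⟩ := hS.exists_bound_of_continuousOn hG.continuousOn
  refine LipschitzOnWith.uniformContinuousOn (K := C.toNNReal) ?_
  refine (convex_Ici 0).lipschitzOnWith_of_nnnorm_hasDerivWithin_le hw fun t ht => ?_
  rw [← NNReal.coe_le_coe, coe_nnnorm]
  exact (hC _ (hmem t ht)).trans (Real.le_coe_toNNReal C)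

/-- If a map converges, its limit is its only cluster point. -/
theorem MapClusterPt.eq_of_tendsto {X ι : Type*} [TopologicalSpace X] [T2Space X] {l : Filter ι}
    {w : ι → X} {a b : X} (h : MapClusterPt a l w) (hw : Tendsto w l (𝓝 b)) : a = b :=
  eq_of_nhds_neBot (h.neBot.mono (inf_le_inf_left _ hw))

namespace DistOpt

/-! ### Linear algebra of the nullspace property -/

variable {N K n : ℕ}

theorem NullspaceProperty.sum_column_eq_zero {E : Matrix (Fin N) (Fin K) ℝ}
    (hE : NullspaceProperty E) (k : Fin K) : ∑ i, E i k = 0 := by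
  have h : (fun _ => 1 : Fin N → ℝ) ∈ {v : Fin N → ℝ | E.transpose.mulVec v = 0} := by
    rw [hE]; exact ⟨1, rfl⟩
  simpa [Matrix.mulVec, dotProduct] using congrFun h k

theorem NullspaceProperty.eq_of_controllerInput_eq_zero {E : Matrix (Fin N) (Fin K) ℝ}
    (hE : NullspaceProperty E) {y : Fin N → Vec n} (hy : ∀ k, controllerInput E y k = 0)
    (i j : Fin N) : y i = y j := by
  ext m
  have h : (fun i => y i m) ∈ {v : Fin N → ℝ | E.transpose.mulVec v = 0} := by
    ext k
    simpa [controllerInput, Matrix.mulVec, dotProduct] using congrArg (fun v : Vec n => v m) (hy k)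
  rw [hE] at h
  obtain ⟨a, ha⟩ := h
  exact (congrFun ha i).trans (congrFun ha j).symm

/-- Otherwise some functional kills the range of `E` but not `g`. Its coefficient vector lies in
`ker Eᵀ`, hence is constant, so its value at `g` is a multiple of `∑ i, g i = 0`. -/
theorem NullspaceProperty.exists_mulVec_eq {E : Matrix (Fin N) (Fin K) ℝ}
    (hE : NullspaceProperty E) {g : Fin N → ℝ} (hg : ∑ i, g i = 0) : ∃ c, E.mulVec c = g := by
  by_contra hne
  have hmem : g ∉ LinearMap.range E.mulVecLin := by simpa using hne
  obtain ⟨φ, hφ, hker⟩ := Submodule.exists_le_ker_of_notMem hmem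
  have hφ_eq : ∀ v, φ v = ∑ i, v i * φ (Pi.single i 1) := fun v => by
    rw [φ.pi_apply_eq_sum_univ v]
    refine Finset.sum_congr rfl fun i _ => congrArg (v i * φ ·) ?_
    ext j
    simp [Pi.single_apply, eq_comm]
  have h : (fun i => φ (Pi.single i 1)) ∈ {v : Fin N → ℝ | E.transpose.mulVec v = 0} := by
    ext k
    have := hker ⟨Pi.single k 1, rfl⟩
    rw [LinearMap.mem_ker, hφ_eq] at this
    simpa [Matrix.mulVec, dotProduct, Pi.single_apply] using this
  rw [hE] at h
  obtain ⟨a, ha⟩ := h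
  apply hφ
  rw [hφ_eq, Finset.sum_congr rfl fun i _ => by rw [congrFun ha i], ← Finset.sum_mul, hg, zero_mul]

theorem NullspaceProperty.exists_agentInput_eq {E : Matrix (Fin N) (Fin K) ℝ}
    (hE : NullspaceProperty E) {g : Fin N → Vec n} (hg : ∑ i, g i = 0) :
    ∃ c : Fin K → Vec n, ∀ i, agentInput E c i = g i := by
  have h : ∀ m, ∃ c, E.mulVec c = fun i => -g i m := fun m => hE.exists_mulVec_eq (by
    simpa using congrArg (fun v : Vec n => v m) hg)
  choose c hc using h
  refine ⟨fun k => WithLp.toLp 2 fun m => c m k, fun i => ?_⟩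
  ext m
  have := congrFun (hc m) i
  simp only [Matrix.mulVec, dotProduct] at this
  simp [agentInput, this]

/-! ### The closed-loop field and its Lyapunov function -/

/-- The right-hand side of the closed loop as a vector field on the pairs `(x, z)`. -/
noncomputable def loopField (f : Fin N → Vec n → ℝ) (α : Fin N → ℝ) (β : Fin K → ℝ)
    (E : Matrix (Fin N) (Fin K) ℝ) (p : (Fin N → Vec n) × (Fin K → Vec n)) :
    (Fin N → Vec n) × (Fin K → Vec n) :=
  (fun i => agentField (α i) (f i) (p.1 i)
      (agentInput E (fun k => controllerOutput (β k) (p.2 k) (controllerInput E p.1 k)) i),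
    fun k => controllerField (β k) (controllerInput E p.1 k))

/-- The weighted squared distance of the state `(x, z)` to the point `(xs 1, zs)`. -/
noncomputable def lyapunov (α : Fin N → ℝ) (β : Fin K → ℝ) (xs : Vec n) (zs : Fin K → Vec n)
    (p : (Fin N → Vec n) × (Fin K → Vec n)) : ℝ :=
  ∑ i, (2 * α i)⁻¹ * ‖p.1 i - xs‖ ^ 2 + ∑ k, (2 * β k)⁻¹ * ‖p.2 k - zs k‖ ^ 2

/-- The decay rate of `lyapunov` along the closed loop. -/
noncomputable def dissipation (f : Fin N → Vec n → ℝ) (β : Fin K → ℝ)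
    (E : Matrix (Fin N) (Fin K) ℝ) (xs : Vec n) (p : (Fin N → Vec n) × (Fin K → Vec n)) : ℝ :=
  ∑ i, ⟪p.1 i - xs, gradient (f i) (p.1 i) - gradient (f i) xs⟫_ℝ +
    ∑ k, β k * ‖controllerInput E p.1 k‖ ^ 2

section Trajectory

variable {f : Fin N → Vec n → ℝ} {α : Fin N → ℝ} {β : Fin K → ℝ}
  {E : Matrix (Fin N) (Fin K) ℝ} {J : Set ℝ}
  {x u y : ℝ → Fin N → Vec n} {z ζ d : ℝ → Fin K → Vec n}

theorem IsTrajectoryOn.ctrl_in_eq (h : IsTrajectoryOn f α β E J x u y z ζ d) {t : ℝ} (ht : t ∈ J) :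
    ζ t = controllerInput E (x t) := by
  ext1 k
  rw [h.ctrl_in t ht k, funext (h.agent_out t ht)]

theorem IsTrajectoryOn.ctrl_out_eq (h : IsTrajectoryOn f α β E J x u y z ζ d) {t : ℝ}
    (ht : t ∈ J) : d t = fun k => controllerOutput (β k) (z t k) (controllerInput E (x t) k) := by
  ext1 k
  rw [h.ctrl_out t ht k, h.ctrl_in_eq ht]

theorem IsTrajectoryOn.hasDerivWithinAt (h : IsTrajectoryOn f α β E J x u y z ζ d) {t : ℝ}
    (ht : t ∈ J) :
    HasDerivWithinAt (fun s => (x s, z s)) (loopField f α β E (x t, z t)) J t := by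
  refine HasDerivWithinAt.prodMk (hasDerivWithinAt_pi.2 fun i => ?_)
    (hasDerivWithinAt_pi.2 fun k => ?_)
  · have := h.agent_dyn t ht i
    rwa [h.agent_in t ht i, h.ctrl_out_eq ht] at this
  · have := h.ctrl_dyn t ht k
    rwa [h.ctrl_in_eq ht] at this

end Trajectory

theorem continuous_controllerInput (E : Matrix (Fin N) (Fin K) ℝ) :
    Continuous (controllerInput (n := n) E) := by
  unfold controllerInput
  fun_prop

theorem continuous_agentInput (E : Matrix (Fin N) (Fin K) ℝ) :
    Continuous (agentInput (n := n) E) := by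
  unfold agentInput
  fun_prop

theorem continuous_controllerOutput (β : Fin K → ℝ) (E : Matrix (Fin N) (Fin K) ℝ) :
    Continuous fun p : (Fin N → Vec n) × (Fin K → Vec n) =>
      fun k => controllerOutput (β k) (p.2 k) (controllerInput E p.1 k) := by
  have := continuous_controllerInput (n := n) E
  unfold controllerOutput
  fun_prop

theorem continuous_loopField {f : Fin N → Vec n → ℝ} (hf : ∀ i, Continuous (gradient (f i)))
    (α : Fin N → ℝ) (β : Fin K → ℝ) (E : Matrix (Fin N) (Fin K) ℝ) :
    Continuous (loopField f α β E) := by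
  have h1 := continuous_controllerInput (n := n) E
  have h2 := (continuous_agentInput (n := n) E).comp (continuous_controllerOutput β E)
  refine Continuous.prodMk (continuous_pi fun i => ?_) (continuous_pi fun k => ?_)
  · have h3 := (continuous_apply i).comp h2
    have h4 := (hf i).comp ((continuous_apply i).comp
      (continuous_fst (X := Fin N → Vec n) (Y := Fin K → Vec n)))
    exact (h4.const_smul (α i)).neg.add (h3.const_smul (α i))
  · exact (((continuous_apply k).comp h1).comp continuous_fst).const_smul (β k)

theorem continuous_lyapunov (α : Fin N → ℝ) (β : Fin K → ℝ) (xs : Vec n) (zs : Fin K → Vec n) :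
    Continuous (lyapunov α β xs zs) := by
  unfold lyapunov
  fun_prop

theorem continuous_dissipation {f : Fin N → Vec n → ℝ} (hf : ∀ i, Continuous (gradient (f i)))
    (β : Fin K → ℝ) (E : Matrix (Fin N) (Fin K) ℝ) (xs : Vec n) :
    Continuous (dissipation f β E xs) := by
  have h1 := continuous_controllerInput (n := n) E
  unfold dissipation
  fun_prop

theorem lyapunov_nonneg {α : Fin N → ℝ} {β : Fin K → ℝ} (hα : ∀ i, 0 < α i) (hβ : ∀ k, 0 < β k)
    (xs : Vec n) (zs : Fin K → Vec n) (p : (Fin N → Vec n) × (Fin K → Vec n)) :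
    0 ≤ lyapunov α β xs zs p :=
  add_nonneg
    (Finset.sum_nonneg fun i _ => mul_nonneg (inv_nonneg.2 (by linarith [hα i])) (sq_nonneg _))
    (Finset.sum_nonneg fun k _ => mul_nonneg (inv_nonneg.2 (by linarith [hβ k])) (sq_nonneg _))

theorem norm_sq_le_lyapunov {α : Fin N → ℝ} {β : Fin K → ℝ} (hα : ∀ i, 0 < α i)
    (hβ : ∀ k, 0 < β k) (xs : Vec n) (zs : Fin K → Vec n)
    (p : (Fin N → Vec n) × (Fin K → Vec n)) :
    (∀ i, ‖p.1 i - xs‖ ^ 2 ≤ 2 * α i * lyapunov α β xs zs p) ∧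
      ∀ k, ‖p.2 k - zs k‖ ^ 2 ≤ 2 * β k * lyapunov α β xs zs p := by
  have h1 : ∀ i ∈ Finset.univ, 0 ≤ (2 * α i)⁻¹ * ‖p.1 i - xs‖ ^ 2 := fun i _ =>
    mul_nonneg (inv_nonneg.2 (by linarith [hα i])) (sq_nonneg _)
  have h2 : ∀ k ∈ Finset.univ, 0 ≤ (2 * β k)⁻¹ * ‖p.2 k - zs k‖ ^ 2 := fun k _ =>
    mul_nonneg (inv_nonneg.2 (by linarith [hβ k])) (sq_nonneg _)
  refine ⟨fun i => ?_, fun k => ?_⟩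
  · rw [← inv_mul_le_iff₀ (by linarith [hα i])]
    exact (Finset.single_le_sum h1 (Finset.mem_univ i)).trans
      (le_add_of_nonneg_right (Finset.sum_nonneg h2))
  · rw [← inv_mul_le_iff₀ (by linarith [hβ k])]
    exact (Finset.single_le_sum h2 (Finset.mem_univ k)).trans
      (le_add_of_nonneg_left (Finset.sum_nonneg h1))

theorem lyapunov_eq_zero_iff {α : Fin N → ℝ} {β : Fin K → ℝ} (hα : ∀ i, 0 < α i)
    (hβ : ∀ k, 0 < β k) (xs : Vec n) (zs : Fin K → Vec n)
    (p : (Fin N → Vec n) × (Fin K → Vec n)) :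
    lyapunov α β xs zs p = 0 ↔ p = (fun _ => xs, zs) := by
  refine ⟨fun h => ?_, fun h => by simp [h, lyapunov]⟩
  have := norm_sq_le_lyapunov hα hβ xs zs p
  rw [h] at this
  refine Prod.ext (funext fun i => ?_) (funext fun k => ?_)
  · simpa [sub_eq_zero] using le_antisymm ((this.1 i).trans_eq (mul_zero _)) (sq_nonneg _)
  · simpa [sub_eq_zero] using le_antisymm ((this.2 k).trans_eq (mul_zero _)) (sq_nonneg _)

theorem exists_isCompact_lyapunov_le {α : Fin N → ℝ} {β : Fin K → ℝ} (hα : ∀ i, 0 < α i)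
    (hβ : ∀ k, 0 < β k) (xs : Vec n) (zs : Fin K → Vec n) (c : ℝ) :
    ∃ S, IsCompact S ∧ ∀ p, lyapunov α β xs zs p ≤ c → p ∈ S := by
  refine ⟨(univ.pi fun i => Metric.closedBall xs √(2 * α i * c)) ×ˢ
    (univ.pi fun k => Metric.closedBall (zs k) √(2 * β k * c)),
    (isCompact_univ_pi fun i => isCompact_closedBall _ _).prod
      (isCompact_univ_pi fun k => isCompact_closedBall _ _), fun p hp => ?_⟩
  have := norm_sq_le_lyapunov hα hβ xs zs p
  refine ⟨fun i _ => ?_, fun k _ => ?_⟩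
  · rw [mem_closedBall_iff_norm]
    exact Real.le_sqrt_of_sq_le ((this.1 i).trans
      (mul_le_mul_of_nonneg_left hp (by linarith [hα i])))
  · rw [mem_closedBall_iff_norm]
    exact Real.le_sqrt_of_sq_le ((this.2 k).trans
      (mul_le_mul_of_nonneg_left hp (by linarith [hβ k])))

/-- The interconnection is lossless, since `-E` and `Eᵀ` are negative adjoints. The shift by `xs`
drops out because the columns of `E` sum to zero. -/
theorem sum_inner_agentInput {E : Matrix (Fin N) (Fin K) ℝ} (hE : ∀ k, ∑ i, E i k = 0)
    (x : Fin N → Vec n) (xs : Vec n) (e : Fin K → Vec n) :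
    ∑ i, ⟪x i - xs, agentInput E e i⟫_ℝ = -∑ k, ⟪e k, controllerInput E x k⟫_ℝ := by
  simp only [agentInput, controllerInput, inner_neg_right, inner_sum, inner_smul_right,
    Finset.sum_neg_distrib]
  rw [Finset.sum_comm]
  refine congrArg _ (Finset.sum_congr rfl fun k _ => ?_)
  have : ∑ i, E i k * ⟪xs, e k⟫_ℝ = 0 := by rw [← Finset.sum_mul, hE, zero_mul]
  simp only [inner_sub_left, mul_sub, Finset.sum_sub_distrib, this, sub_zero]
  exact Finset.sum_congr rfl fun i _ => by rw [real_inner_comm]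

/-- The weights in `lyapunov` cancel the gains `α` and `β`. Any consensus equilibrium may serve as
centre; `xs` need not be known to be a minimizer. -/
theorem hasDerivWithinAt_lyapunov {f : Fin N → Vec n → ℝ} {α : Fin N → ℝ} {β : Fin K → ℝ}
    {E : Matrix (Fin N) (Fin K) ℝ} (hα : ∀ i, 0 < α i) (hβ : ∀ k, 0 < β k)
    (hE : ∀ k, ∑ i, E i k = 0) {xs : Vec n} {zs : Fin K → Vec n}
    (hzs : ∀ i, agentInput E zs i = gradient (f i) xs)
    {w : ℝ → (Fin N → Vec n) × (Fin K → Vec n)} {J : Set ℝ} {t : ℝ}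
    (hw : HasDerivWithinAt w (loopField f α β E (w t)) J t) :
    HasDerivWithinAt (fun s => lyapunov α β xs zs (w s)) (-dissipation f β E xs (w t)) J t := by
  have hx : ∀ i, HasDerivWithinAt (fun s => (w s).1 i) ((loopField f α β E (w t)).1 i) J t :=
    hasDerivWithinAt_pi.1 hw.fst
  have hz : ∀ k, HasDerivWithinAt (fun s => (w s).2 k) ((loopField f α β E (w t)).2 k) J t :=
    hasDerivWithinAt_pi.1 hw.snd
  have h1 := HasDerivWithinAt.fun_sum (u := Finset.univ) fun i _ =>
    (((hx i).sub_const xs).norm_sq.const_mul (2 * α i)⁻¹)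
  have h2 := HasDerivWithinAt.fun_sum (u := Finset.univ) fun k _ =>
    (((hz k).sub_const (zs k)).norm_sq.const_mul (2 * β k)⁻¹)
  refine (h1.add h2).congr_deriv ?_
  set p := w t
  -- Deviation of the controller output from its equilibrium value, which is `zs` since `ζ = 0`
  -- there.
  set e : Fin K → Vec n :=
    fun k => controllerOutput (β k) (p.2 k) (controllerInput E p.1 k) - zs k with he
  have h3 : ∀ i, (2 * α i)⁻¹ * (2 * ⟪p.1 i - xs, (loopField f α β E p).1 i⟫_ℝ) =
      -⟪p.1 i - xs, gradient (f i) (p.1 i) - gradient (f i) xs⟫_ℝ +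
        ⟪p.1 i - xs, agentInput E e i⟫_ℝ := fun i => by
    have hi : agentInput E e i = agentInput E
        (fun k => controllerOutput (β k) (p.2 k) (controllerInput E p.1 k)) i -
          gradient (f i) xs := by
      rw [← hzs i]
      simp only [agentInput, he, smul_sub, Finset.sum_sub_distrib]
      abel
    rw [hi]
    simp only [loopField, agentField, inner_add_right, inner_sub_right, inner_neg_right,
      inner_smul_right]
    have := (hα i).ne'
    field_simp
    ring
  have h4 : ∀ k, (2 * β k)⁻¹ * (2 * ⟪p.2 k - zs k, (loopField f α β E p).2 k⟫_ℝ) =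
      ⟪e k, controllerInput E p.1 k⟫_ℝ - β k * ‖controllerInput E p.1 k‖ ^ 2 := fun k => by
    have hk : e k = (p.2 k - zs k) + β k • controllerInput E p.1 k := by
      simp only [he, controllerOutput]; abel
    rw [hk]
    simp only [loopField, controllerField, inner_add_left, inner_smul_left, inner_smul_right,
      real_inner_self_eq_norm_sq, conj_trivial]
    have := (hβ k).ne'
    field_simp
    ring
  simp only [h3, h4, Finset.sum_add_distrib, Finset.sum_sub_distrib, Finset.sum_neg_distrib,
    sum_inner_agentInput hE, dissipation]
  ring

/-! ### Convexity and the zeros of the dissipation -/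

section Convex

variable {f : Fin N → Vec n → ℝ} {β : Fin K → ℝ} {E : Matrix (Fin N) (Fin K) ℝ}

theorem sum_gradient_eq_zero_of_isMinOn (hdiff : ∀ i, Differentiable ℝ (f i)) {xs : Vec n}
    (hmin : IsMinOn (fun w => ∑ i, f i w) univ xs) : ∑ i, gradient (f i) xs = 0 := by
  have h1 : HasFDerivAt (fun w => ∑ i, f i w) (∑ i, fderiv ℝ (f i) xs) xs :=
    HasFDerivAt.fun_sum fun i _ => (hdiff i xs).hasFDerivAt
  have h2 := (hmin.isLocalMin univ_mem).hasFDerivAt_eq_zero h1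
  simp only [gradient, ← map_sum, h2, map_zero]

/-- The two sides differ by the Bregman distance with the points exchanged, which is nonnegative. -/
theorem bregman_le_inner_gradient_sub (hdiff : ∀ i, Differentiable ℝ (f i))
    (hconv : ∀ i, ConvexOn ℝ univ (f i)) (i : Fin N) (x xs : Vec n) :
    f i x - f i xs - ⟪gradient (f i) xs, x - xs⟫_ℝ ≤
      ⟪x - xs, gradient (f i) x - gradient (f i) xs⟫_ℝ := by
  have h := (hconv i).inner_gradient_le (hdiff i x) xs
  rw [← neg_sub x xs, inner_neg_right, real_inner_comm] at h
  rw [inner_sub_right (x - xs), real_inner_comm (gradient (f i) xs)]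
  linarith

theorem dissipation_nonneg (hβ : ∀ k, 0 < β k) (hdiff : ∀ i, Differentiable ℝ (f i))
    (hconv : ∀ i, ConvexOn ℝ univ (f i)) (xs : Vec n)
    (p : (Fin N → Vec n) × (Fin K → Vec n)) : 0 ≤ dissipation f β E xs p :=
  add_nonneg (Finset.sum_nonneg fun i _ => le_trans
      (sub_nonneg.2 ((hconv i).inner_gradient_le (hdiff i xs) (p.1 i)))
      (bregman_le_inner_gradient_sub hdiff hconv i (p.1 i) xs))
    (Finset.sum_nonneg fun k _ => mul_nonneg (hβ k).le (sq_nonneg _))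

/-- Vanishing `ζ` forces consensus. In the summed Bregman inequality the linear terms then cancel,
so the common point is also a minimizer of the sum, and strict convexity makes it unique. -/
theorem eq_of_dissipation_eq_zero (hβ : ∀ k, 0 < β k) (hE : NullspaceProperty E)
    (hdiff : ∀ i, Differentiable ℝ (f i)) (hconv : ∀ i, ConvexOn ℝ univ (f i))
    (hstrict : StrictConvexOn ℝ univ (fun w : Vec n => ∑ i, f i w)) {xs : Vec n}
    (hmin : IsMinOn (fun w : Vec n => ∑ i, f i w) univ xs)
    {p : (Fin N → Vec n) × (Fin K → Vec n)} (hp : dissipation f β E xs p = 0) (i : Fin N) :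
    p.1 i = xs := by
  have hb : ∀ j ∈ Finset.univ,
      0 ≤ ⟪p.1 j - xs, gradient (f j) (p.1 j) - gradient (f j) xs⟫_ℝ := fun j _ =>
    (sub_nonneg.2 ((hconv j).inner_gradient_le (hdiff j xs) (p.1 j))).trans
      (bregman_le_inner_gradient_sub hdiff hconv j (p.1 j) xs)
  have hk : ∀ k ∈ Finset.univ, 0 ≤ β k * ‖controllerInput E p.1 k‖ ^ 2 := fun k _ =>
    mul_nonneg (hβ k).le (sq_nonneg _)
  obtain ⟨h1, h2⟩ := (add_eq_zero_iff_of_nonneg (Finset.sum_nonneg hb) (Finset.sum_nonneg hk)).1 hp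
  have h3 : ∀ k, controllerInput E p.1 k = 0 := fun k => by
    simpa [(hβ k).ne'] using (Finset.sum_eq_zero_iff_of_nonneg hk).1 h2 k (Finset.mem_univ k)
  have h4 : ∀ j, p.1 j = p.1 i := fun j => hE.eq_of_controllerInput_eq_zero h3 j i
  have h5 : ∑ j, f j (p.1 i) ≤ ∑ j, f j xs := by
    have h := Finset.sum_le_sum fun j (_ : j ∈ Finset.univ) =>
      bregman_le_inner_gradient_sub hdiff hconv j (p.1 j) xs
    rw [h1] at h
    simp only [h4, Finset.sum_sub_distrib, ← sum_inner,
      sum_gradient_eq_zero_of_isMinOn hdiff hmin, inner_zero_left, sub_zero] at h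
    linarith
  exact hstrict.eq_of_isMinOn (fun w hw => h5.trans (hmin hw)) hmin (mem_univ _) (mem_univ _)

end Convex

/-! ### Convergence of trajectories -/

section Main

variable {f : Fin N → Vec n → ℝ} {α : Fin N → ℝ} {β : Fin K → ℝ} {E : Matrix (Fin N) (Fin K) ℝ}
  {xs : Vec n} {w : ℝ → (Fin N → Vec n) × (Fin K → Vec n)} {J : Set ℝ}

theorem antitoneOn_lyapunov (hα : ∀ i, 0 < α i) (hβ : ∀ k, 0 < β k)
    (hE : NullspaceProperty E) (hdiff : ∀ i, Differentiable ℝ (f i))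
    (hconv : ∀ i, ConvexOn ℝ univ (f i)) {zs : Fin K → Vec n}
    (hzs : ∀ i, agentInput E zs i = gradient (f i) xs) (hJ : Convex ℝ J)
    (hw : ∀ t ∈ J, HasDerivWithinAt w (loopField f α β E (w t)) J t) :
    AntitoneOn (fun t => lyapunov α β xs zs (w t)) J :=
  have hV := fun t (ht : t ∈ J) =>
    hasDerivWithinAt_lyapunov hα hβ hE.sum_column_eq_zero hzs (hw t ht)
  antitoneOn_of_hasDerivWithinAt_nonpos hJ (fun t ht => (hV t ht).continuousWithinAt)
    (fun t ht => (hV t (interior_subset ht)).mono interior_subset)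
    (fun t _ => neg_nonpos.2 (dissipation_nonneg hβ hdiff hconv xs (w t)))

theorem exists_tendsto_of_loopField (hα : ∀ i, 0 < α i) (hβ : ∀ k, 0 < β k)
    (hE : NullspaceProperty E) (hdiff : ∀ i, Differentiable ℝ (f i))
    (hconv : ∀ i, ConvexOn ℝ univ (f i))
    (hstrict : StrictConvexOn ℝ univ (fun w : Vec n => ∑ i, f i w))
    (hmin : IsMinOn (fun w : Vec n => ∑ i, f i w) univ xs)
    (hw : ∀ t ∈ Ici (0 : ℝ), HasDerivWithinAt w (loopField f α β E (w t)) (Ici 0) t) :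
    ∃ zs : Fin K → Vec n, (∀ i, agentInput E zs i = gradient (f i) xs) ∧
      Tendsto w atTop (𝓝 (fun _ => xs, zs)) := by
  have hgrad : ∀ i, Continuous (gradient (f i)) := fun i => (hconv i).continuous_gradient (hdiff i)
  -- `z₀` need not be the limit of `z`; it only provides compactness and the decay of the
  -- dissipation.
  obtain ⟨z₀, hz₀⟩ := hE.exists_agentInput_eq (sum_gradient_eq_zero_of_isMinOn hdiff hmin)
  obtain ⟨S, hS, hSmem⟩ := exists_isCompact_lyapunov_le hα hβ xs z₀ (lyapunov α β xs z₀ (w 0))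
  have hmono : ∀ {zs : Fin K → Vec n}, (∀ i, agentInput E zs i = gradient (f i) xs) →
      AntitoneOn (fun t => lyapunov α β xs zs (w t)) (Ici 0) := fun hzs =>
    antitoneOn_lyapunov hα hβ hE hdiff hconv hzs (convex_Ici 0) hw
  have hwS : ∀ t ∈ Ici (0 : ℝ), w t ∈ S := fun t ht => hSmem _ (hmono hz₀ self_mem_Ici ht ht)
  have hwS' : ∀ᶠ t in atTop, w t ∈ S := (eventually_ge_atTop 0).mono hwS
  have hfield := continuous_loopField hgrad α β E
  have hwu := uniformContinuousOn_of_hasDerivWithinAt_of_mem_isCompact hfield hS hw hwS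
  -- the dissipation tends to zero, hence the agents converge
  have hdc := continuous_dissipation hgrad β E xs
  have hlim : ∀ {zs : Fin K → Vec n}, (∀ i, agentInput E zs i = gradient (f i) xs) →
      ∃ l, Tendsto (fun t => lyapunov α β xs zs (w t)) atTop (𝓝 l) := fun {zs} hzs => by
    -- Freezing negative times at `0` makes the function antitone on all of `ℝ`.
    have hanti : Antitone fun t : ℝ => lyapunov α β xs zs (w (max t 0)) := fun s t hst =>
      hmono hzs (le_max_right s 0) (le_max_right t 0) (max_le_max_right 0 hst)
    refine ⟨_, (tendsto_atTop_ciInf hanti ⟨0, ?_⟩).congr' ?_⟩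
    · rintro _ ⟨t, rfl⟩
      exact lyapunov_nonneg hα hβ _ _ _
    · filter_upwards [eventually_ge_atTop 0] with t ht
      rw [max_eq_left ht]
  obtain ⟨l₀, hl₀⟩ := hlim hz₀
  have hdiss : Tendsto (fun t => dissipation f β E xs (w t)) atTop (𝓝 0) := by
    have := tendsto_deriv_zero_of_tendsto
      (fun t ht => hasDerivWithinAt_lyapunov hα hβ hE.sum_column_eq_zero hz₀ (hw t ht)) hl₀
      ((hS.uniformContinuousOn_of_continuous hdc.neg.continuousOn).comp hwu hwS)
    simpa using this.neg
  have hclust : ∀ p, MapClusterPt p atTop w → p.1 = fun _ => xs := fun p hp =>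
    funext (eq_of_dissipation_eq_zero hβ hE hdiff hconv hstrict hmin
      ((hp.continuousAt_comp hdc.continuousAt).eq_of_tendsto hdiss))
  have hx : Tendsto (fun t => (w t).1) atTop (𝓝 fun _ => xs) := by
    have h := hS.tendsto_nhdsSet_of_mapClusterPt (s' := Prod.fst ⁻¹' {fun _ => xs}) hwS'
      fun p _ hp => hclust p hp
    rw [← nhdsSet_singleton]
    exact (continuous_fst.tendsto_nhdsSet (mapsTo_preimage _ _)).comp h
  have hx' := tendsto_deriv_zero_of_tendsto (fun t ht => (hw t ht).fst) hx
    ((hS.uniformContinuousOn_of_continuous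
      (continuous_fst.comp hfield).continuousOn).comp hwu hwS)
  -- any cluster point of the trajectory is an equilibrium
  obtain ⟨p, -, hp⟩ := hS.exists_mapClusterPt_of_frequently hwS'.frequently
  have hp1 := hclust p hp
  have hp0 : (loopField f α β E p).1 = 0 :=
    (hp.continuousAt_comp (continuous_fst.comp hfield).continuousAt).eq_of_tendsto hx'
  have hzeta : ∀ k, controllerInput E p.1 k = 0 := fun k => by
    simp [hp1, controllerInput, ← Finset.sum_smul, hE.sum_column_eq_zero k]
  have hpz : ∀ i, agentInput E p.2 i = gradient (f i) xs := fun i => by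
    have h := congrFun hp0 i
    simp only [loopField, agentField, controllerOutput, hzeta, smul_zero, add_zero,
      Pi.zero_apply, neg_add_eq_zero] at h
    rw [hp1] at h
    exact (smul_right_injective _ (hα i).ne' h).symm
  refine ⟨p.2, hpz, hS.tendsto_nhds_of_unique_mapClusterPt hwS' fun q _ hq => ?_⟩
  -- Recentred at `p`, the Lyapunov function has a limit, which is `0` since `p` is a cluster point;
  -- hence any cluster point `q` equals `p`.
  obtain ⟨l, hl⟩ := hlim hpz
  have hlc := continuous_lyapunov α β xs p.2
  have hl0 := (hp.continuousAt_comp hlc.continuousAt).eq_of_tendsto hl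
  rw [(lyapunov_eq_zero_iff hα hβ xs p.2 p).2 (Prod.ext hp1 rfl)] at hl0
  rw [← lyapunov_eq_zero_iff hα hβ xs p.2, hl0]
  exact (hq.continuousAt_comp hlc.continuousAt).eq_of_tendsto hl

end Main

end DistOpt

/-! ### The three claims -/

theorem mainTheorem4 {N K n : ℕ}
    (f : Fin N → DistOpt.Vec n → ℝ) (α : Fin N → ℝ) (β : Fin K → ℝ)
    (E : Matrix (Fin N) (Fin K) ℝ)
    (hα : ∀ i, 0 < α i) (hβ : ∀ k, 0 < β k)
    (hE : DistOpt.NullspaceProperty E)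
    (hdiff : ∀ i, Differentiable ℝ (f i))
    (hconv : ∀ i, ConvexOn ℝ Set.univ (f i))
    (hstrict : StrictConvexOn ℝ Set.univ (fun w : DistOpt.Vec n => ∑ i, f i w))
    (yopt : DistOpt.Vec n)
    (hopt : IsMinOn (fun w : DistOpt.Vec n => ∑ i, f i w) Set.univ yopt) :
    -- every trajectory on `[0, ∞)` converges to an equilibrium in the optimal manifold
    (∀ (x u y : ℝ → Fin N → DistOpt.Vec n) (z ζ d : ℝ → Fin K → DistOpt.Vec n),
      DistOpt.IsTrajectoryOn f α β E (Set.Ici 0) x u y z ζ d →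
      ∃ (x' u' y' : Fin N → DistOpt.Vec n) (z' ζ' d' : Fin K → DistOpt.Vec n),
        DistOpt.IsEquilibrium f α β E x' u' y' z' ζ' d' ∧
        (y', d') ∈ DistOpt.optimalManifold N K yopt ∧
        Filter.Tendsto x Filter.atTop (nhds x') ∧
        Filter.Tendsto u Filter.atTop (nhds u') ∧
        Filter.Tendsto y Filter.atTop (nhds y') ∧
        Filter.Tendsto z Filter.atTop (nhds z') ∧
        Filter.Tendsto ζ Filter.atTop (nhds ζ') ∧
        Filter.Tendsto d Filter.atTop (nhds d')) ∧
    -- no trajectory escapes in finite time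
    (∀ (T : ℝ) (x u y : ℝ → Fin N → DistOpt.Vec n) (z ζ d : ℝ → Fin K → DistOpt.Vec n),
      DistOpt.IsTrajectoryOn f α β E (Set.Ico 0 T) x u y z ζ d →
      Bornology.IsBounded (x '' Set.Ico 0 T) ∧ Bornology.IsBounded (z '' Set.Ico 0 T)) ∧
    -- the set of equilibria is positively invariant
    (∀ (x u y : ℝ → Fin N → DistOpt.Vec n) (z ζ d : ℝ → Fin K → DistOpt.Vec n),
      DistOpt.IsTrajectoryOn f α β E (Set.Ici 0) x u y z ζ d →
      DistOpt.IsEquilibrium f α β E (x 0) (u 0) (y 0) (z 0) (ζ 0) (d 0) →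
      ∀ t, 0 ≤ t → x t = x 0 ∧ z t = z 0) := by
  have hcol := hE.sum_column_eq_zero
  refine ⟨fun x u y z ζ d h => ?_, fun T x u y z ζ d h => ?_, fun x u y z ζ d h h0 t ht => ?_⟩
  · obtain ⟨zs, hzs, hlim⟩ := DistOpt.exists_tendsto_of_loopField hα hβ hE hdiff hconv hstrict hopt
      fun t ht => h.hasDerivWithinAt ht
    have hζ0 : ∀ k, DistOpt.controllerInput E (fun _ => yopt) k = 0 := fun k => by
      simp [DistOpt.controllerInput, ← Finset.sum_smul, hcol k]
    have hev : ∀ᶠ t : ℝ in atTop, t ∈ Ici (0 : ℝ) := eventually_ge_atTop 0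
    have hx : Tendsto x atTop (𝓝 fun _ => yopt) := (continuous_fst.tendsto _).comp hlim
    have hζ : Tendsto ζ atTop (𝓝 0) := by
      have := ((DistOpt.continuous_controllerInput E).tendsto _).comp hx
      rw [funext hζ0] at this
      exact this.congr' (hev.mono fun t ht => (h.ctrl_in_eq ht).symm)
    have hd : Tendsto d atTop (𝓝 zs) := by
      have := ((DistOpt.continuous_controllerOutput β E).tendsto _).comp hlim
      simp only [hζ0, DistOpt.controllerOutput, smul_zero, add_zero] at this
      exact this.congr' (hev.mono fun t ht => (h.ctrl_out_eq ht).symm)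
    refine ⟨fun _ => yopt, DistOpt.agentInput E zs, fun _ => yopt, zs, 0, zs,
      ⟨fun i => ?_, fun _ => rfl, fun k => ?_, fun k => ?_, fun k => (hζ0 k).symm, fun _ => rfl⟩,
      fun _ => rfl, hx, ?_, ?_, (continuous_snd.tendsto _).comp hlim, hζ, hd⟩
    · simp [DistOpt.agentField, hzs]
    · simp [DistOpt.controllerField]
    · simp [DistOpt.controllerOutput]
    · exact (((DistOpt.continuous_agentInput E).tendsto _).comp hd).congr'
        (hev.mono fun t ht => (funext (h.agent_in t ht)).symm)
    · exact hx.congr' (hev.mono fun t ht => (funext (h.agent_out t ht)).symm)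
  · obtain ⟨zs, hzs⟩ :=
      hE.exists_agentInput_eq (DistOpt.sum_gradient_eq_zero_of_isMinOn hdiff hopt)
    obtain ⟨S, hS, hSmem⟩ := DistOpt.exists_isCompact_lyapunov_le hα hβ yopt zs
      (DistOpt.lyapunov α β yopt zs (x 0, z 0))
    have hmem : ∀ t ∈ Ico 0 T, (x t, z t) ∈ S := fun t ht => hSmem _ <|
      DistOpt.antitoneOn_lyapunov hα hβ hE hdiff hconv hzs (convex_Ico 0 T)
        (fun t ht => h.hasDerivWithinAt ht) ⟨le_rfl, ht.1.trans_lt ht.2⟩ ht ht.1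
    refine ⟨(hS.image continuous_fst).isBounded.subset ?_,
      (hS.image continuous_snd).isBounded.subset ?_⟩
    · rintro _ ⟨t, ht, rfl⟩
      exact ⟨_, hmem t ht, rfl⟩
    · rintro _ ⟨t, ht, rfl⟩
      exact ⟨_, hmem t ht, rfl⟩
  · have hζ0 : ∀ k, ζ 0 k = 0 := fun k => by
      simpa [DistOpt.controllerField, (hβ k).ne'] using h0.ctrl_dyn k
    have hd0 : d 0 = z 0 := funext fun k => by simp [h0.ctrl_out k, DistOpt.controllerOutput, hζ0]
    have hg : ∀ i, DistOpt.agentInput E (z 0) i = gradient (f i) (x 0 i) := fun i => by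
      have hi := h0.agent_dyn i
      rw [DistOpt.agentField, neg_add_eq_zero, h0.agent_in i, hd0] at hi
      exact (smul_right_injective _ (hα i).ne' hi).symm
    have hx0 : ∀ i j, x 0 i = x 0 j := fun i j => by
      rw [← h0.agent_out i, ← h0.agent_out j]
      exact hE.eq_of_controllerInput_eq_zero (fun k => (h0.ctrl_in k).symm.trans (hζ0 k)) i j
    -- Without agents there is no common value to read off, and any point serves.
    obtain ⟨xs, hxs⟩ : ∃ xs, x 0 = fun _ => xs := by
      rcases isEmpty_or_nonempty (Fin N) with hN | ⟨⟨i⟩⟩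
      · exact ⟨yopt, funext fun i => hN.elim i⟩
      · exact ⟨x 0 i, funext fun j => hx0 j i⟩
    simp only [hxs] at hg
    -- Centred at the initial equilibrium, the Lyapunov function starts at `0` and cannot grow.
    have hanti := DistOpt.antitoneOn_lyapunov hα hβ hE hdiff hconv hg (convex_Ici 0)
      (fun t ht => h.hasDerivWithinAt ht) self_mem_Ici ht ht
    have hzero := le_antisymm
      (hanti.trans_eq ((DistOpt.lyapunov_eq_zero_iff hα hβ xs (z 0) _).2 (by rw [hxs])))
      (DistOpt.lyapunov_nonneg hα hβ xs (z 0) (x t, z t))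
    have heq := (DistOpt.lyapunov_eq_zero_iff hα hβ xs (z 0) _).1 hzero
    rw [hxs]
    exact ⟨congrArg Prod.fst heq, congrArg Prod.snd heq⟩
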